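/- Let $R$ be an associative ring with $1$, not necessarily commutative; "module" means unital right $R$-module. A submodule $P\le M$ is pure if for every left $R$-module $N$ the map $P\otimes_R N\to M\otimes_R N$ induced by the inclusion is injective. A module $M$ is called - pure extending if every pure submodule of $M$ is an essential submodule of some direct summand of $M$; - pure $C_2$ if every pure submodule of $M$ that is isomorphic to a direct summand of $M$ is itself a direct summand of $M$; - pure $C_3$ if, for all direct summands $K,L$ of $M$ with $K\cap L=0$, the submodule $K\oplus L$ is pure in $M$ if and only if it is a direct summand of $M$; - $Q$-pure-injective, for a module $Q$, if every homomorphism from a pure submodule of $Q$ to $M$ extends to a homomorphism $Q\to M$; quasi-pure-injective if it is $M$-pure-injective; and pure-injective if it is $Q$-pure-injective for every module $Q$. Then the following conditions are equivalent: 1. $R$ is right semisimple, that is, $R_R$ is a semisimple module; 2. every pure $C_3$ module is projective; 3. every pure $C_2$ module is projective; 4. every quasi-pure-injective module is projective; 5. every pure-injective module is projective; 6. every pure extending module is projective. -/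

import Mathlib

open MulOpposite

universe u v w

/-!
Right `R`-modules are modules over `Rᵐᵒᵖ`: `op r • m` is the product `m r`.
-/

section BalancedTensor

variable (R : Type u) [Ring R]
variable (M : Type*) [AddCommGroup M] [Module Rᵐᵒᵖ M]
variable (N : Type*) [AddCommGroup N] [Module R N]

/-- The subgroup of `M ⊗[ℤ] N` generated by the elements `(m r) ⊗ n - m ⊗ (r n)`. -/
def balancedRelations : AddSubgroup (TensorProduct ℤ M N) :=
  AddSubgroup.closure {x | ∃ (m : M) (r : R) (n : N),
    x = TensorProduct.tmul ℤ (op r • m) n - TensorProduct.tmul ℤ m (r • n)}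

/-- The tensor product `M ⊗_R N` (an abelian group) of a right `R`-module `M` and a left
`R`-module `N` over a not necessarily commutative ring `R`. -/
abbrev BalancedTensor : Type _ := TensorProduct ℤ M N ⧸ balancedRelations R M N

variable {M} {M' : Type*} [AddCommGroup M'] [Module Rᵐᵒᵖ M']

theorem balancedRelations_le_comap (f : M →ₗ[Rᵐᵒᵖ] M') :
    balancedRelations R M N ≤
      (balancedRelations R M' N).comap
        (LinearMap.rTensor N f.toAddMonoidHom.toIntLinearMap).toAddMonoidHom := by
  refine (AddSubgroup.closure_le _).2 ?_
  rintro _ ⟨m, r, n, rfl⟩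
  refine AddSubgroup.subset_closure ⟨f m, r, n, ?_⟩
  simp

/-- The homomorphism `f ⊗ N : M ⊗_R N → M' ⊗_R N` induced by `f : M → M'`. -/
def balancedMap (f : M →ₗ[Rᵐᵒᵖ] M') : BalancedTensor R M N →+ BalancedTensor R M' N :=
  QuotientAddGroup.map (balancedRelations R M N) (balancedRelations R M' N)
    (LinearMap.rTensor N f.toAddMonoidHom.toIntLinearMap).toAddMonoidHom
    (balancedRelations_le_comap R N f)

theorem balancedMap_mk_tmul (f : M →ₗ[Rᵐᵒᵖ] M') (m : M) (n : N) :
    balancedMap R N f (QuotientAddGroup.mk (TensorProduct.tmul ℤ m n)) =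
      QuotientAddGroup.mk (TensorProduct.tmul ℤ (f m) n) :=
  rfl

end BalancedTensor

section Purity

variable (R : Type u) [Ring R]
variable {M : Type v} [AddCommGroup M] [Module Rᵐᵒᵖ M]

/-- `P` is a pure submodule of the right `R`-module `M`: for each left `R`-module `N`, the map
`P ⊗_R N → M ⊗_R N` induced by the inclusion is injective. -/
def IsPureSubmodule (P : Submodule Rᵐᵒᵖ M) : Prop :=
  ∀ (N : Type (max u v)) [AddCommGroup N] [Module R N],
    Function.Injective (balancedMap R N P.subtype)

variable {R}

/-- `K` is an essential submodule of `D` (both being submodules of `M`). -/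
def IsEssentialIn (K D : Submodule Rᵐᵒᵖ M) : Prop :=
  K ≤ D ∧ ∀ X : Submodule Rᵐᵒᵖ M, X ≤ D → K ⊓ X = ⊥ → X = ⊥

/-- `K` is a direct summand of `M`. -/
def IsDirectSummand (K : Submodule Rᵐᵒᵖ M) : Prop :=
  ∃ L : Submodule Rᵐᵒᵖ M, IsCompl K L

variable (R) (M)

/-- Pure extending (pure `C₁`): every pure submodule is essential in a direct summand. -/
def IsPureExtending : Prop :=
  ∀ P : Submodule Rᵐᵒᵖ M, IsPureSubmodule R P →
    ∃ D : Submodule Rᵐᵒᵖ M, IsDirectSummand D ∧ IsEssentialIn P D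

/-- Pure `C₂`: every pure submodule that is isomorphic to a direct summand is itself a direct
summand. -/
def IsPureC2 : Prop :=
  ∀ P : Submodule Rᵐᵒᵖ M, IsPureSubmodule R P →
    (∃ D : Submodule Rᵐᵒᵖ M, IsDirectSummand D ∧ Nonempty (P ≃ₗ[Rᵐᵒᵖ] D)) → IsDirectSummand P

/-- Pure `C₃`: for direct summands `K`, `L` with `K ∩ L = 0`, the submodule `K ⊕ L` is pure if and
only if it is a direct summand. -/
def IsPureC3 : Prop :=
  ∀ K L : Submodule Rᵐᵒᵖ M, IsDirectSummand K → IsDirectSummand L → K ⊓ L = ⊥ →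
    (IsPureSubmodule R (K ⊔ L) ↔ IsDirectSummand (K ⊔ L))

/-- `M` is `Q`-pure-injective: every homomorphism from a pure submodule of `Q` to `M` extends
to `Q`. -/
def IsPureInjectiveRel (Q : Type w) [AddCommGroup Q] [Module Rᵐᵒᵖ Q] : Prop :=
  ∀ (L : Submodule Rᵐᵒᵖ Q), IsPureSubmodule R L → ∀ f : L →ₗ[Rᵐᵒᵖ] M,
    ∃ g : Q →ₗ[Rᵐᵒᵖ] M, ∀ x : L, g x = f x

/-- `M` is quasi-pure-injective: it is `M`-pure-injective. -/
def IsQuasiPureInjective : Prop :=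
  IsPureInjectiveRel R M M

/-- `M` is pure-injective: it is `Q`-pure-injective for every right `R`-module `Q`. -/
def IsPureInjective : Prop :=
  ∀ (Q : Type (max u v)) [AddCommGroup Q] [Module Rᵐᵒᵖ Q], IsPureInjectiveRel R M Q

end Purity

/-!
Over a semisimple ring every module is projective, which gives all implications from the first
condition.

Conversely, a ring is semisimple as soon as its simple modules are projective
(`IsSemisimpleModule.of_projective_quotients`). All submodules of a simple module are direct
summands, so a simple module is pure `C₃`, pure `C₂`, quasi-pure-injective and pure extending; if
one of these four properties forces projectivity, then simple modules are projective.

A simple module `S` need not be pure-injective, but it embeds as a pure submodule into its double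
character module `S⁺⁺` (`isPureSubmodule_range_doubleChar`), and `S⁺⁺` is pure-injective, like each
character module of a left module (`LeftModuleChar.isPureInjective`). If pure-injective modules
are projective, then `S` is isomorphic to a cyclic pure submodule of the projective module
`S⁺⁺`. Such a submodule is a direct summand, as purity tested on a cyclic left module `R/L`
yields an explicit retraction (`IsPureSubmodule.projective_span_singleton`).
-/

/-! ### The universal property of the balanced tensor product -/

section BalancedTensor

variable {R : Type u} [Ring R]
variable {M : Type*} [AddCommGroup M] [Module Rᵐᵒᵖ M]
variable {N : Type*} [AddCommGroup N] [Module R N]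
variable {A : Type*} [AddCommGroup A]

/-- The universal property of `M ⊗_R N`: the homomorphism to `A` induced by a balanced
biadditive map. -/
def BalancedTensor.lift (φ : M →+ N →+ A)
    (hφ : ∀ (m : M) (r : R) (n : N), φ (op r • m) n = φ m (r • n)) :
    BalancedTensor R M N →+ A :=
  QuotientAddGroup.lift (balancedRelations R M N)
    (TensorProduct.liftAddHom φ fun z m n => by simp) <| by
      refine (AddSubgroup.closure_le _).2 ?_
      rintro _ ⟨m, r, n, rfl⟩
      simp [AddMonoidHom.mem_ker, hφ]

variable (R) in
/-- The pure tensor `m ⊗ n`, as a biadditive map `M → N → M ⊗_R N`. -/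
def BalancedTensor.mk : M →+ N →+ BalancedTensor R M N :=
  AddMonoidHom.mk' (fun m => AddMonoidHom.mk'
      (fun n => QuotientAddGroup.mk (TensorProduct.tmul ℤ m n))
      fun n n' => by rw [TensorProduct.tmul_add, QuotientAddGroup.mk_add])
    fun m m' => by
      ext n
      simp [TensorProduct.add_tmul]

theorem BalancedTensor.mk_smul (m : M) (r : R) (n : N) :
    BalancedTensor.mk R (op r • m) n = BalancedTensor.mk R m (r • n) :=
  sub_eq_zero.1 <| (QuotientAddGroup.eq_zero_iff _).2 <| AddSubgroup.subset_closure ⟨m, r, n, rfl⟩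

@[simp]
theorem BalancedTensor.lift_mk (φ : M →+ N →+ A)
    (hφ : ∀ (m : M) (r : R) (n : N), φ (op r • m) n = φ m (r • n)) (m : M) (n : N) :
    BalancedTensor.lift φ hφ (BalancedTensor.mk R m n) = φ m n :=
  rfl

theorem BalancedTensor.hom_ext {f g : BalancedTensor R M N →+ A}
    (h : ∀ m n, f (BalancedTensor.mk R m n) = g (BalancedTensor.mk R m n)) : f = g := by
  ext t
  induction t using TensorProduct.induction_on with
  | zero => simp
  | tmul m n => exact h m n
  | add t t' ht ht' => rw [map_add, map_add, ht, ht']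

@[simp]
theorem balancedMap_mk {M' : Type*} [AddCommGroup M'] [Module Rᵐᵒᵖ M'] (f : M →ₗ[Rᵐᵒᵖ] M')
    (m : M) (n : N) :
    balancedMap R N f (BalancedTensor.mk R m n) = BalancedTensor.mk R (f m) n :=
  rfl

end BalancedTensor

/-! ### Direct summands and simple modules -/

section Simple

variable {R : Type u} [Ring R] {M : Type v} [AddCommGroup M] [Module Rᵐᵒᵖ M]

theorem IsDirectSummand.isPureSubmodule {P : Submodule Rᵐᵒᵖ M} (hP : IsDirectSummand P) :
    IsPureSubmodule R P := by
  intro N _ _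
  obtain ⟨L, hL⟩ := hP
  have h : (balancedMap R N (P.projectionOnto L hL)).comp (balancedMap R N P.subtype) =
      AddMonoidHom.id _ := by
    refine BalancedTensor.hom_ext fun m n => ?_
    simp
  exact Function.LeftInverse.injective (g := balancedMap R N (P.projectionOnto L hL))
    fun t => DFunLike.congr_fun h t

variable [IsSimpleModule Rᵐᵒᵖ M]

theorem IsDirectSummand.of_isSimpleModule (P : Submodule Rᵐᵒᵖ M) : IsDirectSummand P :=
  exists_isCompl P

variable (R M)

theorem IsPureC3.of_isSimpleModule : IsPureC3 R M := fun _ _ _ _ _ =>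
  ⟨fun _ => .of_isSimpleModule _, fun h => h.isPureSubmodule⟩

theorem IsPureC2.of_isSimpleModule : IsPureC2 R M := fun _ _ _ =>
  .of_isSimpleModule _

theorem IsPureExtending.of_isSimpleModule : IsPureExtending R M := fun P _ =>
  ⟨P, .of_isSimpleModule P, le_rfl, fun X hX h => by rwa [inf_eq_right.2 hX] at h⟩

theorem IsQuasiPureInjective.of_isSimpleModule : IsQuasiPureInjective R M := by
  intro L _ f
  obtain ⟨K, hK⟩ := IsDirectSummand.of_isSimpleModule L
  exact ⟨f ∘ₗ L.projectionOnto K hK, fun x => by simp⟩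

end Simple

/-- A finitely generated module over a ring with projective simple modules is semisimple: a
maximal submodule containing the socle would have a simple complement, which lies in the socle. -/
theorem IsSemisimpleModule.of_projective_quotients {A : Type*} [Ring A] {M : Type*}
    [AddCommGroup M] [Module A M] [Module.Finite A M]
    (h : ∀ m : Submodule A M, IsCoatom m → Module.Projective A (M ⧸ m)) :
    IsSemisimpleModule A M := by
  apply IsSemisimpleModule.of_sSup_simples_eq_top
  obtain hs | ⟨m, hm, hle⟩ := eq_top_or_exists_le_coatom
    (sSup {S : Submodule A M | IsSimpleModule A S})
  · exact hs
  have := h m hm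
  obtain ⟨g, hg⟩ := Module.projective_lifting_property m.mkQ LinearMap.id m.mkQ_surjective
  have hc : IsCompl m (LinearMap.range g) := by
    have hgq (y : M ⧸ m) : m.mkQ (g y) = y := LinearMap.congr_fun hg y
    refine ⟨Submodule.disjoint_def.2 ?_, Submodule.codisjoint_iff_exists_add_eq.2 fun z => ?_⟩
    · rintro _ hz ⟨y, rfl⟩
      rw [← hgq y, m.mkQ_apply, (Submodule.Quotient.mk_eq_zero m).2 hz, map_zero]
    · refine ⟨z - g (m.mkQ z), g (m.mkQ z), ?_, ⟨_, rfl⟩, sub_add_cancel _ _⟩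
      rw [← Submodule.Quotient.mk_eq_zero m, ← m.mkQ_apply, map_sub, hgq, sub_self]
  have hsimple : IsSimpleModule A (LinearMap.range g) :=
    isSimpleModule_iff_isAtom.2 (hc.isCoatom_iff_isAtom.1 hm)
  have hgm : LinearMap.range g ≤ m := (le_sSup (a := LinearMap.range g) hsimple).trans hle
  exact absurd (hc.disjoint.symm.eq_bot_of_le hgm) (isSimpleModule_iff_isAtom.1 hsimple).1

/-! ### Cyclic pure submodules of projective modules -/

/-- Let `P = xR`. Write `x = ∑ eₚ fₚ(x)` in a dual basis of the projective module `F`, and let `L`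
be the left ideal generated by the `fₚ(x)`. The tensor `x ⊗ 1` vanishes in `F ⊗ R/L`, hence in
`P ⊗ R/L` by purity, and this says that `x = x l` for some `l = ∑ cₚ fₚ(x)` in `L`. Then `y ↦ ∑ (x cₚ) fₚ(y)`
is a retraction of `F` onto `P`. -/
theorem IsPureSubmodule.projective_span_singleton {R : Type u} [Ring R] {F : Type v}
    [AddCommGroup F] [Module Rᵐᵒᵖ F] [Module.Projective Rᵐᵒᵖ F] {x : F}
    (hP : IsPureSubmodule R (Submodule.span Rᵐᵒᵖ {x})) :
    Module.Projective Rᵐᵒᵖ (Submodule.span Rᵐᵒᵖ {x}) := by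
  obtain ⟨s, hs⟩ := Module.projective_def'.1 ‹Module.Projective Rᵐᵒᵖ F›
  have hsum (y : F) : y = (s y).sum fun p a => a • p :=
    (LinearMap.congr_fun hs y).symm
  set P := Submodule.span Rᵐᵒᵖ {x}
  let x' : P := ⟨x, Submodule.mem_span_singleton_self x⟩
  let L : Submodule R R := Submodule.span R (Set.range fun p => unop (s x p))
  let q : R →ₗ[R] ULift.{max u v} (R ⧸ L) := ULift.moduleEquiv.symm.toLinearMap ∘ₗ L.mkQ
  have hq (r : R) (hr : r ∈ L) : q r = 0 := by
    simp only [q, LinearMap.comp_apply, Submodule.mkQ_apply, (Submodule.Quotient.mk_eq_zero L).2 hr,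
      map_zero]
  have hzeroF : BalancedTensor.mk R x (q 1) = 0 := by
    rw [hsum x, Finsupp.sum, map_sum, AddMonoidHom.finsetSum_apply]
    refine Finset.sum_eq_zero fun p _ => ?_
    rw [← op_unop (s x p), BalancedTensor.mk_smul, ← map_smul,
      hq _ (by simpa using Submodule.subset_span (Set.mem_range_self p)), map_zero]
  have hzeroP : BalancedTensor.mk R x' (q 1) = 0 := by
    apply hP
    rw [balancedMap_mk, map_zero]
    exact hzeroF
  -- The subgroup `H = x L` of `P` equals `P L`, and `P ⊗ R/L → P/PL` sends `x ⊗ 1` to the class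
  -- of `x`.
  let act (y : P) : R →+ P := AddMonoidHom.mk' (fun r => op r • y) fun a b => by
    rw [op_add, add_smul]
  let H : AddSubgroup P := L.toAddSubgroup.map (act x')
  have hH (y : P) (l : R) (hl : l ∈ L) : op l • y ∈ H := by
    obtain ⟨y, hy⟩ := y
    obtain ⟨a, rfl⟩ := Submodule.mem_span_singleton.1 hy
    refine ⟨unop a * l, L.smul_mem _ hl, ?_⟩
    ext
    simp [act, x', mul_smul]
  let ψ : P →+ ULift.{max u v} (R ⧸ L) →+ P ⧸ H := AddMonoidHom.mk'
    (fun y => (QuotientAddGroup.lift L.toAddSubgroup ((QuotientAddGroup.mk' H).comp (act y))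
      fun l hl => (QuotientAddGroup.eq_zero_iff _).2 (hH y l hl)).comp
        (AddEquiv.ulift : ULift.{max u v} (R ⧸ L) ≃+ R ⧸ L).toAddMonoidHom) fun y z => by
      ext ⟨r⟩
      obtain ⟨r, rfl⟩ := L.mkQ_surjective r
      change (QuotientAddGroup.mk (op r • (y + z)) : P ⧸ H) = _
      rw [smul_add]
      rfl
  have hψ (y : P) (r : R) : ψ y (q r) = QuotientAddGroup.mk (op r • y) := rfl
  have hxH : x' ∈ H := by
    have := congrArg (BalancedTensor.lift ψ fun y r n => by
      obtain ⟨n⟩ := n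
      obtain ⟨a, rfl⟩ := L.mkQ_surjective n
      change ψ (op r • y) (q a) = ψ y (r • q a)
      rw [← map_smul, hψ, hψ, smul_smul, smul_eq_mul, op_mul]) hzeroP
    rw [BalancedTensor.lift_mk, map_zero, hψ, op_one, one_smul] at this
    exact (QuotientAddGroup.eq_zero_iff _).1 this
  obtain ⟨l, hl, hlx⟩ := hxH
  obtain ⟨c, rfl⟩ := (Finsupp.mem_span_range_iff_exists_finsupp).1 hl
  let φ : F →ₗ[Rᵐᵒᵖ] P := Finsupp.linearCombination Rᵐᵒᵖ (fun p => op (c p) • x') ∘ₗ s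
  have hφx : φ x = x' := by
    change ((s x).sum fun p a => a • op (c p) • x') = x'
    change act x' (c.sum fun p a => a • unop (s x p)) = x' at hlx
    classical
    rw [Finsupp.sum_of_support_subset c (Finset.subset_union_left (s₂ := (s x).support)) _
      (by simp), map_sum] at hlx
    rw [Finsupp.sum_of_support_subset (s x) (Finset.subset_union_right (s₁ := c.support)) _
      (by simp)]
    refine (Finset.sum_congr rfl fun p _ => ?_).trans hlx
    simp [act, mul_smul]
  refine Module.Projective.of_split P.subtype φ (LinearMap.ext fun ⟨y, hy⟩ => ?_)
  obtain ⟨a, rfl⟩ := Submodule.mem_span_singleton.1 hy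
  change φ (a • x) = a • x'
  rw [map_smul, hφx]

/-! ### Character modules -/

section Character

/-- The character group `Hom_ℤ(M, ℚ/ℤ)` of a right `R`-module `M`, regarded as a left `R`-module
by `(r c)(m) = c(m r)`. -/
def RightModuleChar (M : Type*) [AddCommGroup M] : Type _ := CharacterModule M

/-- The character group `Hom_ℤ(N, ℚ/ℤ)` of a left `R`-module `N`, regarded as a right `R`-module
by `(c r)(n) = c(r n)`. -/
def LeftModuleChar (N : Type*) [AddCommGroup N] : Type _ := CharacterModule N

variable {R : Type u} [Ring R]
variable {M : Type*} [AddCommGroup M] [Module Rᵐᵒᵖ M]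
variable {N : Type*} [AddCommGroup N] [Module R N]

instance : AddCommGroup (RightModuleChar M) := inferInstanceAs (AddCommGroup (CharacterModule M))

instance : AddCommGroup (LeftModuleChar N) := inferInstanceAs (AddCommGroup (CharacterModule N))

/-- Evaluation of characters, as a biadditive map. -/
def RightModuleChar.eval : RightModuleChar M →+ M →+ AddCircle (1 : ℚ) :=
  AddMonoidHom.id (M →+ AddCircle (1 : ℚ))

/-- Evaluation of characters, as a biadditive map. -/
def LeftModuleChar.eval : LeftModuleChar N →+ N →+ AddCircle (1 : ℚ) :=
  AddMonoidHom.id (N →+ AddCircle (1 : ℚ))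

theorem RightModuleChar.ext {c d : RightModuleChar M} (h : ∀ m, c.eval m = d.eval m) : c = d :=
  AddMonoidHom.ext h

theorem LeftModuleChar.ext {c d : LeftModuleChar N} (h : ∀ n, c.eval n = d.eval n) : c = d :=
  AddMonoidHom.ext h

instance : SMul R (RightModuleChar M) where
  smul r c := c.eval.comp (DistribSMul.toAddMonoidHom M (op r))

instance : SMul Rᵐᵒᵖ (LeftModuleChar N) where
  smul r c := c.eval.comp (DistribSMul.toAddMonoidHom N (unop r))

theorem RightModuleChar.eval_smul (r : R) (c : RightModuleChar M) (m : M) :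
    (r • c).eval m = c.eval (op r • m) := rfl

theorem LeftModuleChar.eval_smul (r : Rᵐᵒᵖ) (c : LeftModuleChar N) (n : N) :
    (r • c).eval n = c.eval (unop r • n) := rfl

instance : Module R (RightModuleChar M) where
  one_smul c := RightModuleChar.ext fun m => by simp [RightModuleChar.eval_smul]
  mul_smul r s c := RightModuleChar.ext fun m => by simp [RightModuleChar.eval_smul, mul_smul]
  smul_zero r := RightModuleChar.ext fun m => by simp [RightModuleChar.eval_smul]
  smul_add r c d := RightModuleChar.ext fun m => by simp [RightModuleChar.eval_smul]
  add_smul r s c := RightModuleChar.ext fun m => by simp [RightModuleChar.eval_smul, add_smul]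
  zero_smul c := RightModuleChar.ext fun m => by simp [RightModuleChar.eval_smul]

instance : Module Rᵐᵒᵖ (LeftModuleChar N) where
  one_smul c := LeftModuleChar.ext fun m => by simp [LeftModuleChar.eval_smul]
  mul_smul r s c := LeftModuleChar.ext fun m => by simp [LeftModuleChar.eval_smul, mul_smul]
  smul_zero r := LeftModuleChar.ext fun m => by simp [LeftModuleChar.eval_smul]
  smul_add r c d := LeftModuleChar.ext fun m => by simp [LeftModuleChar.eval_smul]
  add_smul r s c := LeftModuleChar.ext fun m => by simp [LeftModuleChar.eval_smul, add_smul]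
  zero_smul c := LeftModuleChar.ext fun m => by simp [LeftModuleChar.eval_smul]

/-- By the adjunction `Hom_R(Q, Hom_ℤ(N, ℚ/ℤ)) = Hom_ℤ(Q ⊗_R N, ℚ/ℤ)`, extending a homomorphism
from a pure submodule `L` of `Q` to the character module of `N` amounts to extending a character
from `L ⊗_R N` to `Q ⊗_R N`, which is possible because `ℚ/ℤ` is divisible. -/
theorem LeftModuleChar.isPureInjective (R : Type u) [Ring R] (N : Type (max u v))
    [AddCommGroup N] [Module R N] : IsPureInjective.{u, max u v} R (LeftModuleChar N) := by
  intro Q _ _ L hL f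
  let c : CharacterModule (BalancedTensor R L N) :=
    BalancedTensor.lift (LeftModuleChar.eval.comp f.toAddMonoidHom) fun y r n => by
      change (f (op r • y)).eval n = (f y).eval (r • n)
      rw [map_smul, LeftModuleChar.eval_smul, unop_op]
  obtain ⟨d, hd⟩ := CharacterModule.dual_surjective_of_injective
    (balancedMap R N L.subtype).toIntLinearMap (hL N) c
  let d' : BalancedTensor R Q N →+ AddCircle (1 : ℚ) := d
  refine ⟨{ toFun := fun y => d'.comp (BalancedTensor.mk R y)
            map_add' := fun y z => LeftModuleChar.ext fun n => ?_
            map_smul' := fun r y => LeftModuleChar.ext fun n => ?_ }, fun y => ?_⟩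
  · change d' _ = d' _ + d' _
    rw [map_add, AddMonoidHom.add_apply, map_add]
  · change d' (BalancedTensor.mk R (op (unop r) • y) n) = d' (BalancedTensor.mk R y (unop r • n))
    rw [BalancedTensor.mk_smul]
  · refine LeftModuleChar.ext fun n => ?_
    exact DFunLike.congr_fun hd (BalancedTensor.mk R y n)

variable (R M) in
/-- The canonical homomorphism from a right module to its double character module. -/
def doubleChar : M →ₗ[Rᵐᵒᵖ] LeftModuleChar (RightModuleChar M) where
  toFun m := RightModuleChar.eval.flip m
  map_add' m m' := by rw [map_add]; rfl
  map_smul' _ _ := rfl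

theorem doubleChar_injective : Function.Injective (doubleChar R M) := by
  refine (injective_iff_map_eq_zero _).2 fun m hm => ?_
  refine CharacterModule.eq_zero_of_character_apply fun c => ?_
  exact DFunLike.congr_fun (congrArg LeftModuleChar.eval hm) (c : RightModuleChar M)

/-- A character `c` of `P ⊗_R N`, where `P` is the image of `M` in its double character module,
is the restriction of the character `ξ ⊗ n ↦ ξ (m ↦ c (m ⊗ n))`. As characters separate
points, the kernel of `P ⊗_R N → M⁺⁺ ⊗_R N` is zero. -/
theorem isPureSubmodule_range_doubleChar (R : Type u) [Ring R] (M : Type v) [AddCommGroup M]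
    [Module Rᵐᵒᵖ M] : IsPureSubmodule R (LinearMap.range (doubleChar R M)) := by
  intro N _ _
  set P := LinearMap.range (doubleChar R M)
  refine (injective_iff_map_eq_zero _).2 fun t ht => ?_
  refine CharacterModule.eq_zero_of_character_apply fun c => ?_
  let c' : BalancedTensor R P N →+ AddCircle (1 : ℚ) := c
  let g : N →+ RightModuleChar M := AddMonoidHom.mk'
    (fun n => c'.comp (((BalancedTensor.mk R).flip n).comp
      (doubleChar R M).rangeRestrict.toAddMonoidHom)) fun n n' => by
        refine RightModuleChar.ext fun m => ?_
        change c' _ = c' _ + c' _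
        rw [map_add, ← map_add c']
        rfl
  have hg (n : N) (m : M) : (g n).eval m =
      c' (BalancedTensor.mk R ((doubleChar R M).rangeRestrict m) n) := rfl
  have hgs (r : R) (n : N) : g (r • n) = r • g n := RightModuleChar.ext fun m => by
    rw [RightModuleChar.eval_smul, hg, hg, ← BalancedTensor.mk_smul,
      (doubleChar R M).rangeRestrict.map_smul]
  let e : BalancedTensor R (LeftModuleChar (RightModuleChar M)) N →+ AddCircle (1 : ℚ) :=
    BalancedTensor.lift ((AddMonoidHom.compHom.flip g).comp LeftModuleChar.eval) fun ξ r n => by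
      change (op r • ξ).eval (g n) = ξ.eval (g (r • n))
      rw [hgs, LeftModuleChar.eval_smul, unop_op]
  have he : e.comp (balancedMap R N P.subtype) = c' := by
    refine BalancedTensor.hom_ext fun p n => ?_
    obtain ⟨_, m, rfl⟩ := p
    rfl
  change c' t = 0
  rw [← he, AddMonoidHom.comp_apply, ht, map_zero]

end Character

/-! ### Semisimplicity from projective simple modules -/

/-- The image of a simple module in its double character module is a cyclic pure submodule of a
pure-injective module. -/
theorem projective_of_pureInjective_projective {R : Type u} [Ring R]
    (h : ∀ (M : Type (max u v)) [AddCommGroup M] [Module Rᵐᵒᵖ M],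
      IsPureInjective R M → Module.Projective Rᵐᵒᵖ M)
    (S : Type (max u v)) [AddCommGroup S] [Module Rᵐᵒᵖ S] [IsSimpleModule Rᵐᵒᵖ S] :
    Module.Projective Rᵐᵒᵖ S := by
  have := h (LeftModuleChar (RightModuleChar S)) (LeftModuleChar.isPureInjective R _)
  have := IsSimpleModule.nontrivial Rᵐᵒᵖ S
  obtain ⟨x, hx⟩ := exists_ne (0 : S)
  have hspan : LinearMap.range (doubleChar R S) = Submodule.span Rᵐᵒᵖ {doubleChar R S x} := by
    rw [LinearMap.range_eq_map, ← IsSimpleModule.span_singleton_eq_top Rᵐᵒᵖ hx,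
      Submodule.map_span, Set.image_singleton]
  have hpure := isPureSubmodule_range_doubleChar R S
  rw [hspan] at hpure
  have := IsPureSubmodule.projective_span_singleton.{u, max u v} hpure
  rw [← hspan] at this
  exact .of_equiv (LinearEquiv.ofInjective _ (doubleChar_injective (R := R) (M := S))).symm

theorem isSemisimpleModule_of_projective_simple {R : Type u} [Ring R]
    (h : ∀ (S : Type (max u v)) [AddCommGroup S] [Module Rᵐᵒᵖ S] [IsSimpleModule Rᵐᵒᵖ S],
      Module.Projective Rᵐᵒᵖ S) :
    IsSemisimpleModule Rᵐᵒᵖ R := by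
  have : Module.Finite Rᵐᵒᵖ R :=
    ⟨⟨{1}, by
      rw [Finset.coe_singleton, Submodule.eq_top_iff']
      exact fun r => Submodule.mem_span_singleton.2 ⟨op r, by simp⟩⟩⟩
  refine .of_projective_quotients fun m hm => ?_
  have : IsSimpleModule Rᵐᵒᵖ (R ⧸ m) := isSimpleModule_iff_isCoatom.2 hm
  let e : ULift.{v} (R ⧸ m) ≃ₗ[Rᵐᵒᵖ] R ⧸ m := ULift.moduleEquiv
  have : IsSimpleModule Rᵐᵒᵖ (ULift.{v} (R ⧸ m)) := .congr e
  have := h (ULift.{v} (R ⧸ m))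
  exact .of_equiv e

theorem isSemisimpleRing_mulOpposite {R : Type u} [Ring R] (h : IsSemisimpleModule Rᵐᵒᵖ R) :
    IsSemisimpleRing Rᵐᵒᵖ :=
  .congr (M := R)
    { opAddEquiv.symm with
      map_smul' := fun _ _ => rfl }

theorem mainTheorem3 (R : Type u) [Ring R] :
    List.TFAE [
      IsSemisimpleModule Rᵐᵒᵖ R,
      ∀ (M : Type (max u v)) [AddCommGroup M] [Module Rᵐᵒᵖ M],
        IsPureC3 R M → Module.Projective Rᵐᵒᵖ M,
      ∀ (M : Type (max u v)) [AddCommGroup M] [Module Rᵐᵒᵖ M],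
        IsPureC2 R M → Module.Projective Rᵐᵒᵖ M,
      ∀ (M : Type (max u v)) [AddCommGroup M] [Module Rᵐᵒᵖ M],
        IsQuasiPureInjective R M → Module.Projective Rᵐᵒᵖ M,
      ∀ (M : Type (max u v)) [AddCommGroup M] [Module Rᵐᵒᵖ M],
        IsPureInjective R M → Module.Projective Rᵐᵒᵖ M,
      ∀ (M : Type (max u v)) [AddCommGroup M] [Module Rᵐᵒᵖ M],
        IsPureExtending R M → Module.Projective Rᵐᵒᵖ M] := by
  have proj (h : IsSemisimpleModule Rᵐᵒᵖ R) (M : Type (max u v)) [AddCommGroup M]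
      [Module Rᵐᵒᵖ M] : Module.Projective Rᵐᵒᵖ M :=
    have := isSemisimpleRing_mulOpposite h
    Module.projective_of_isSemisimpleRing Rᵐᵒᵖ M
  tfae_have 1 → 2 := fun h M _ _ _ => proj h M
  tfae_have 1 → 3 := fun h M _ _ _ => proj h M
  tfae_have 1 → 4 := fun h M _ _ _ => proj h M
  tfae_have 1 → 5 := fun h M _ _ _ => proj h M
  tfae_have 1 → 6 := fun h M _ _ _ => proj h M
  tfae_have 2 → 1 := fun h => isSemisimpleModule_of_projective_simple.{u, v} fun S _ _ _ =>
    h S (.of_isSimpleModule R S)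
  tfae_have 3 → 1 := fun h => isSemisimpleModule_of_projective_simple.{u, v} fun S _ _ _ =>
    h S (.of_isSimpleModule R S)
  tfae_have 4 → 1 := fun h => isSemisimpleModule_of_projective_simple.{u, v} fun S _ _ _ =>
    h S (.of_isSimpleModule R S)
  tfae_have 5 → 1 := fun h => isSemisimpleModule_of_projective_simple.{u, v} fun S _ _ _ =>
    projective_of_pureInjective_projective.{u, v} h S
  tfae_have 6 → 1 := fun h => isSemisimpleModule_of_projective_simple.{u, v} fun S _ _ _ =>
    h S (.of_isSimpleModule R S)
  tfae_finish
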